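/- \textbf{Theorem (convexity of functions via second-order subdifferentials).} Work in $\mathbb{R}^n$ with the Euclidean inner product and norm (and likewise in products of such spaces). For $\Omega\subset\mathbb{R}^m$ and $\bar z\in\Omega$, the regular normal cone $\widehat N_\Omega(\bar z)$ is the set of all $v$ with $\limsup_{z\to\bar z,\ z\in\Omega\setminus\{\bar z\}}\frac{\langle v,z-\bar z\rangle}{\|z-\bar z\|}\le 0$, and the limiting normal cone $N_\Omega(\bar z)$ is the set of all limits $v=\lim_k v_k$ with $v_k\in\widehat N_\Omega(z_k)$, $z_k\in\Omega$, $z_k\to\bar z$. For $\varphi:\mathbb{R}^n\to(-\infty,\infty]$, the limiting subdifferential is $$\partial\varphi(x)=\{v\in\mathbb{R}^n : (v,-1)\in N_{\operatorname{epi}\varphi}(x,\varphi(x))\}\quad\text{if }\varphi(x)<\infty,$$ where $\operatorname{epi}\varphi=\{(x,\alpha)\in\mathbb{R}^n\times\mathbb{R}:\alpha\ge\varphi(x)\}$, and $\partial\varphi(x)=\emptyset$ if $\varphi(x)=\infty$; its graph is $\operatorname{gph}\partial\varphi=\{(x,y): y\in\partial\varphi(x)\}$. For $(x,y)\in\operatorname{gph}\partial\varphi$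 and $w\in\mathbb{R}^n$, the combined and the limiting (Mordukhovich) second-order subdifferentials are $$\breve\partial^2\varphi(x,y)(w)=\{z : (z,-w)\in\widehat N_{\operatorname{gph}\partial\varphi}(x,y)\},\qquad \partial^2\varphi(x,y)(w)=\{z : (z,-w)\in N_{\operatorname{gph}\partial\varphi}(x,y)\}.$$ For $s\in\mathbb{R}$, $\varphi$ is $s$-convex if $$\varphi((1-\lambda)x+\lambda y)\le(1-\lambda)\varphi(x)+\lambda\varphi(y)-\tfrac{s}{2}\lambda(1-\lambda)\|x-y\|^2\quad\text{for all }x,y\in\mathbb{R}^n,\ \lambda\in(0,1);$$ it is convex if it is $0$-convex, and weakly convex if it is $s$-convex for some $s<0$. Let $\varphi:\mathbb{R}^n\to(-\infty,\infty]$ be proper (not identically $\infty$) and lower semicontinuous. Then the following assertions are equivalent: (i) $\varphi$ is convex. (ii) $\varphi$ is weakly convex and $\langle z,w\rangle\ge 0$ for all $(x,y)\in\operatorname{gph}\partial\varphi$, $w\in\mathbb{R}^n$ and $z\in\breve\partial^2\varphi(x,y)(w)$. (iii) $\varphi$ is weakly convex and $\langle z,w\rangle\ge 0$ for all $(x,y)\in\operatorname{gph}\partial\varphi$,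 $w\in\mathbb{R}^n$ and $z\in\partial^2\varphi(x,y)(w)$. -/

import Mathlib

open Filter Topology

noncomputable section

namespace VarAnalysis

section Normals

variable {H : Type*} [NormedAddCommGroup H] [InnerProductSpace ℝ H]

/-- The (Fréchet) regular normal cone to `Ω` at `zbar ∈ Ω`:
all `v` with `limsup ⟨v, z - zbar⟩ / ‖z - zbar‖ ≤ 0` as `z → zbar`, `z ∈ Ω`, `z ≠ zbar`.
The upper limit is taken in the extended reals, so that it is `-∞` at an isolated point of `Ω`.
The cone is empty when `zbar ∉ Ω`. -/
def regularNormalCone (Ω : Set H) (zbar : H) : Set H :=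
  {v | zbar ∈ Ω ∧
    limsup (fun z : H => ((inner ℝ v (z - zbar) / ‖z - zbar‖ : ℝ) : EReal))
      (𝓝[Ω \ {zbar}] zbar) ≤ 0}

/-- The (Mordukhovich) limiting normal cone to `Ω` at `zbar ∈ Ω`. -/
def limitingNormalCone (Ω : Set H) (zbar : H) : Set H :=
  {v | zbar ∈ Ω ∧ ∃ (z : ℕ → H) (w : ℕ → H),
    (∀ k, z k ∈ Ω) ∧ Tendsto z atTop (𝓝 zbar) ∧ Tendsto w atTop (𝓝 v) ∧
    ∀ k, w k ∈ regularNormalCone Ω (z k)}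

end Normals

section Coderivatives

variable {X Y : Type*} [NormedAddCommGroup X] [InnerProductSpace ℝ X]
  [NormedAddCommGroup Y] [InnerProductSpace ℝ Y]

/-- The graph of a set-valued map, in the product space with its Euclidean structure. -/
def graph (F : X → Set Y) : Set (WithLp 2 (X × Y)) :=
  {p | p.snd ∈ F p.fst}

/-- The regular coderivative of `F` at `(x, y)`, as a set-valued map `Y ⇉ X`. -/
def regularCoderivative (F : X → Set Y) (x : X) (y : Y) (v : Y) : Set X :=
  {u | WithLp.toLp 2 (u, -v) ∈ regularNormalCone (graph F) (WithLp.toLp 2 (x, y))}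

/-- The limiting coderivative of `F` at `(x, y)`, as a set-valued map `Y ⇉ X`. -/
def limitingCoderivative (F : X → Set Y) (x : X) (y : Y) (v : Y) : Set X :=
  {u | WithLp.toLp 2 (u, -v) ∈ limitingNormalCone (graph F) (WithLp.toLp 2 (x, y))}

end Coderivatives

section Functions

variable {X : Type*} [NormedAddCommGroup X] [InnerProductSpace ℝ X]

/-- `φ` takes values in `(-∞, ∞]` and is not identically `∞`. -/
def IsProper (φ : X → EReal) : Prop :=
  (∀ x, φ x ≠ ⊥) ∧ ∃ x, φ x ≠ ⊤

/-- The effective domain. -/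
def effDomain (φ : X → EReal) : Set X :=
  {x | φ x < ⊤}

/-- The epigraph, in the product space with its Euclidean structure. -/
def epigraph (φ : X → EReal) : Set (WithLp 2 (X × ℝ)) :=
  {p | φ p.fst ≤ (p.snd : EReal)}

/-- The basic/limiting subdifferential of `φ`; it is empty outside the effective domain. -/
def limitingSubdifferential (φ : X → EReal) (x : X) : Set X :=
  {v | x ∈ effDomain φ ∧
    WithLp.toLp 2 (v, (-1 : ℝ)) ∈
      limitingNormalCone (epigraph φ) (WithLp.toLp 2 (x, (φ x).toReal))}

/-- `s`-convexity of `φ : X → (-∞, ∞]` on the set `Ω`. -/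
def SConvexOn (s : ℝ) (Ω : Set X) (φ : X → EReal) : Prop :=
  ∀ x ∈ Ω, ∀ y ∈ Ω, ∀ t : ℝ, 0 < t → t < 1 →
    φ ((1 - t) • x + t • y) ≤
      ((1 - t : ℝ) : EReal) * φ x + (t : EReal) * φ y
        - ((s / 2 * t * (1 - t) * ‖x - y‖ ^ 2 : ℝ) : EReal)

/-- Convexity: `s`-convexity on the whole space with `s = 0`. -/
def IsConvex (φ : X → EReal) : Prop :=
  SConvexOn 0 Set.univ φ

/-- Weak convexity: `s`-convexity on the whole space for some `s < 0`. -/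
def IsWeaklyConvex (φ : X → EReal) : Prop :=
  ∃ s : ℝ, s < 0 ∧ SConvexOn s Set.univ φ

/-- The combined second-order subdifferential of `φ` at `x` relative to `v`. -/
def combinedSecondSubdifferential (φ : X → EReal) (x v u : X) : Set X :=
  regularCoderivative (limitingSubdifferential φ) x v u

/-- The limiting second-order subdifferential of `φ` at `x` relative to `v`. -/
def limitingSecondSubdifferential (φ : X → EReal) (x v u : X) : Set X :=
  limitingCoderivative (limitingSubdifferential φ) x v u

end Functions

end VarAnalysis

end

open Filter Topology

namespace VarAnalysis

/-! ### Regular normals, and testing them along curves -/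

section Normals

variable {H : Type*} [NormedAddCommGroup H] [InnerProductSpace ℝ H]

/-! Weak convexity gives global control of the subdifferential: `v ∈ ∂φ(x)` exactly when `v`
supports `φ` at `x` up to the error `r/2 * ‖z - x‖ ^ 2`. For `l * r ≤ 1/2` the resolvent `J = (I + l
∂φ)⁻¹` is then single-valued, defined everywhere and Lipschitz, and `gph ∂φ` is a Lipschitz graph in
the rotated coordinate `p = x + l y`. Statements about normals to the graph become statements about
`J`.

From (ii) to (i): if `v` is a proximal subgradient of `⟨q, J ·⟩`, then `(v - q, l v)` is a regular
normal to the graph, so (ii) says `‖v‖ ^ 2 ≤ ⟨q, v⟩`. A minimization argument turns this pointwise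
bound into firm nonexpansiveness of `J`. Hence `I - J` is monotone and the Moreau envelope has exact
affine supports. As `l → 0` the prox points converge, and lower semicontinuity carries the convexity
inequality over to `φ`.

From (i) to (ii): given a normal `(z, -w)`, move the resolvent parameter in the direction `z - w`.
Monotonicity of `∂φ` yields `‖z - w‖ ≤ ‖z + w‖`, which is `⟨z, w⟩ ≥ 0`.

(ii) and (iii) are equivalent because limiting normals are limits of regular ones and `⟨z, w⟩ ≥ 0`
is a closed condition. -/

theorem mem_regularNormalCone_iff {Ω : Set H} {x v : H} :
    v ∈ regularNormalCone Ω x ↔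
      x ∈ Ω ∧ ∀ ε : ℝ, 0 < ε → ∀ᶠ z in 𝓝[Ω] x, inner ℝ v (z - x) ≤ ε * ‖z - x‖ := by
  unfold regularNormalCone
  simp only [Set.mem_ofPred_eq]
  refine and_congr_right fun _ => ⟨fun h ε hε => ?_, fun h => ?_⟩
  · have h1 := eventually_lt_of_limsup_lt
      (lt_of_le_of_lt h (EReal.coe_pos.2 hε))
    rw [eventually_nhdsWithin_iff] at h1 ⊢
    filter_upwards [h1] with z hz hzΩ
    by_cases hzx : z = x
    · simp [hzx]
    · have h2 := EReal.coe_lt_coe_iff.1 (hz ⟨hzΩ, hzx⟩)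
      have h3 : 0 < ‖z - x‖ := norm_pos_iff.2 (sub_ne_zero.2 hzx)
      exact ((div_lt_iff₀ h3).1 h2).le
  · refine le_of_forall_gt_imp_ge_of_dense fun b hb => ?_
    obtain ⟨ε, hε, hεb⟩ := EReal.lt_iff_exists_real_btwn.1 hb
    have h1 := h ε (EReal.coe_pos.1 hε)
    refine (limsup_le_of_le (h := ?_)).trans hεb.le
    · rw [eventually_nhdsWithin_iff] at h1 ⊢
      filter_upwards [h1] with z hz hzΩ
      have h3 : 0 < ‖z - x‖ := norm_pos_iff.2 (sub_ne_zero.2 hzΩ.2)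
      exact EReal.coe_le_coe_iff.2 ((div_le_iff₀ h3).2 (hz hzΩ.1))

/-- A proximal normal is a regular normal. -/
theorem mem_regularNormalCone_of_quadratic {Ω : Set H} {x v : H} (hx : x ∈ Ω) (C : ℝ)
    (h : ∀ z ∈ Ω, inner ℝ v (z - x) ≤ C * ‖z - x‖ ^ 2) : v ∈ regularNormalCone Ω x := by
  refine mem_regularNormalCone_iff.2 ⟨hx, fun ε hε => ?_⟩
  have h1 : ∀ᶠ z in 𝓝 x, C * ‖z - x‖ < ε := by
    have : Tendsto (fun z => C * ‖z - x‖) (𝓝 x) (𝓝 (C * ‖x - x‖)) :=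
      (by fun_prop : Continuous fun z => C * ‖z - x‖).tendsto x
    rw [sub_self, norm_zero, mul_zero] at this
    exact this.eventually_lt_const hε
  rw [eventually_nhdsWithin_iff]
  filter_upwards [h1] with z hz hzΩ
  nlinarith [h z hzΩ, norm_nonneg (z - x)]

theorem regularNormalCone_subset_limitingNormalCone (Ω : Set H) (x : H) :
    regularNormalCone Ω x ⊆ limitingNormalCone Ω x := fun v hv =>
  ⟨hv.1, fun _ => x, fun _ => v, fun _ => hv.1, tendsto_const_nhds, tendsto_const_nhds,
    fun _ => hv⟩

/-- A regular normal makes an obtuse angle with the initial direction of a curve in the set. -/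
theorem inner_le_zero_of_mem_regularNormalCone {Ω : Set H} {x v : H}
    (hv : v ∈ regularNormalCone Ω x) {d : ℝ → H} {d₀ : H}
    (hd : Tendsto d (𝓝[>] 0) (𝓝 d₀)) (hΩ : ∀ᶠ t : ℝ in 𝓝[>] 0, x + t • d t ∈ Ω) :
    inner ℝ v d₀ ≤ 0 := by
  have hε := (mem_regularNormalCone_iff.1 hv).2
  have ht : Tendsto (fun t : ℝ => t) (𝓝[>] 0) (𝓝 0) := tendsto_nhdsWithin_of_tendsto_nhds tendsto_id
  have hc : Tendsto (fun t : ℝ => x + t • d t) (𝓝[>] 0) (𝓝[Ω] x) := by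
    refine tendsto_nhdsWithin_iff.2 ⟨?_, hΩ⟩
    simpa using tendsto_const_nhds.add (ht.smul hd)
  have key : ∀ ε : ℝ, 0 < ε → inner ℝ v d₀ ≤ ε * ‖d₀‖ := by
    intro ε h0
    refine le_of_tendsto_of_tendsto (tendsto_const_nhds.inner hd) (hd.norm.const_mul ε) ?_
    filter_upwards [hc.eventually (hε ε h0), self_mem_nhdsWithin] with t h1 h2
    have h2 : 0 < t := h2
    rw [add_sub_cancel_left, inner_smul_right, norm_smul, Real.norm_of_nonneg h2.le] at h1
    nlinarith
  have : Tendsto (fun ε : ℝ => ε * ‖d₀‖) (𝓝[>] 0) (𝓝 (0 * ‖d₀‖)) := ht.mul_const _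
  rw [zero_mul] at this
  refine ge_of_tendsto this ?_
  filter_upwards [self_mem_nhdsWithin] with ε h using key ε h

end Normals

theorem coe_mul_ne_bot_of_pos {c : ℝ} (hc : 0 < c) {b : EReal} (hb : b ≠ ⊥) :
    (c : EReal) * b ≠ ⊥ := by
  induction b with
  | bot => exact absurd rfl hb
  | coe b => exact EReal.coe_ne_bot (c * b)
  | top => simp [EReal.coe_mul_top_of_pos hc]

/-! ### Subgradients of weakly convex functions are global -/

section WeakConvexity

variable {X : Type*} [NormedAddCommGroup X] [InnerProductSpace ℝ X]

/-- `(-r)`-convexity of `φ`, expressed through real points of the epigraph. -/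
def EpiWeaklyConvex (r : ℝ) (φ : X → EReal) : Prop :=
  ∀ (x y : X) (α β t : ℝ), 0 < t → t < 1 → φ x ≤ α → φ y ≤ β →
    φ ((1 - t) • x + t • y) ≤
      ((1 - t) * α + t * β + r / 2 * t * (1 - t) * ‖x - y‖ ^ 2 : ℝ)

/-- `v` is a global subgradient of `φ` at `x`, up to the quadratic error `r / 2 * ‖z - x‖ ^ 2`. -/
def IsQuadSubgradient (r : ℝ) (φ : X → EReal) (x v : X) : Prop :=
  ∃ a : ℝ, φ x ≤ a ∧ ∀ (z : X) (γ : ℝ), φ z ≤ γ →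
    a + inner ℝ v (z - x) - r / 2 * ‖z - x‖ ^ 2 ≤ γ

variable {φ : X → EReal} {r s : ℝ}

theorem SConvexOn.epiWeaklyConvex (h : SConvexOn s Set.univ φ) : EpiWeaklyConvex (-s) φ := by
  intro x y α β t h0 h1 hx hy
  refine (h x trivial y trivial t h0 h1).trans ?_
  have hx' := mul_le_mul_of_nonneg_left hx (EReal.coe_nonneg.2 (sub_nonneg.2 h1.le))
  have hy' := mul_le_mul_of_nonneg_left hy (EReal.coe_nonneg.2 h0.le)
  refine (EReal.sub_le_sub (add_le_add hx' hy') le_rfl).trans (le_of_eq ?_)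
  norm_cast
  ring

theorem EpiWeaklyConvex.sConvexOn (h : EpiWeaklyConvex r φ) (hbot : ∀ x, φ x ≠ ⊥) :
    SConvexOn (-r) Set.univ φ := by
  intro x _ y _ t h0 h1
  have h1' : 0 < 1 - t := sub_pos.2 h1
  -- An infinite value makes the right-hand side `⊤`, because the other term is not `⊥`.
  by_cases hx : φ x = ⊤
  · rw [hx, EReal.coe_mul_top_of_pos h1', EReal.top_add_of_ne_bot, EReal.top_sub_coe]
    · exact le_top
    · exact coe_mul_ne_bot_of_pos h0 (hbot y)
  by_cases hy : φ y = ⊤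
  · rw [hy, EReal.coe_mul_top_of_pos h0, EReal.add_top_of_ne_bot, EReal.top_sub_coe]
    · exact le_top
    · exact coe_mul_ne_bot_of_pos h1' (hbot x)
  have hx' := EReal.coe_toReal hx (hbot x)
  have hy' := EReal.coe_toReal hy (hbot y)
  refine (h x y _ _ t h0 h1 hx'.ge hy'.ge).trans (le_of_eq ?_)
  rw [← hx', ← hy']
  simp only [EReal.toReal_coe]
  norm_cast
  ring

/-- The quadratic support makes `(v, -1)` a proximal normal to the epigraph with constant `r / 2`.
-/
theorem IsQuadSubgradient.mem_limitingSubdifferential (hbot : ∀ x, φ x ≠ ⊥) (hr : 0 ≤ r)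
    {x v : X} (h : IsQuadSubgradient r φ x v) : v ∈ limitingSubdifferential φ x := by
  obtain ⟨a, hxa, ha⟩ := h
  have hlt : φ x < ⊤ := lt_of_le_of_lt hxa (EReal.coe_lt_top a)
  have hx' := EReal.coe_toReal hlt.ne (hbot x)
  refine ⟨hlt, regularNormalCone_subset_limitingNormalCone _ _
    (mem_regularNormalCone_of_quadratic (by simp [epigraph, hx']) (r / 2) ?_)⟩
  rintro ⟨⟨z, γ⟩⟩ hz
  have h1 := ha z γ hz
  have h2 : (φ x).toReal ≤ a := by rw [← EReal.coe_le_coe_iff, hx']; exact hxa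
  rw [WithLp.prod_norm_sq_eq_of_L2]
  simp only [WithLp.prod_inner_apply, WithLp.ofLp_sub, Prod.fst_sub, Prod.snd_sub, WithLp.fst,
    WithLp.snd, real_inner_eq_re_inner]
  simp
  nlinarith [mul_nonneg hr (sq_nonneg (γ - (φ x).toReal))]

/-- Nearby regular normals are tested against every point of the epigraph, so the resulting
inequality is global and survives the limit. -/
theorem EpiWeaklyConvex.isQuadSubgradient_of_mem (hbot : ∀ x, φ x ≠ ⊥)
    (hφ : EpiWeaklyConvex r φ) {x v : X} (h : v ∈ limitingSubdifferential φ x) :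
    IsQuadSubgradient r φ x v := by
  obtain ⟨hlt, -, p, w, hp, hpx, hwv, hw⟩ := h
  have hlt : φ x < ⊤ := hlt
  have hx' := EReal.coe_toReal hlt.ne (hbot x)
  refine ⟨(φ x).toReal, hx'.ge, fun u γ hu => ?_⟩
  have key : ∀ k, inner ℝ (w k).fst (u - (p k).fst) + (w k).snd *
      (γ - (p k).snd + r / 2 * ‖u - (p k).fst‖ ^ 2) ≤ 0 := by
    intro k
    -- The curve is the segment from `p k` to `(u, γ)`, raised by `r/2 * t * (1 - t) * ‖u - (p
    -- k).fst‖ ^ 2`; weak convexity keeps it in the epigraph.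
    have := inner_le_zero_of_mem_regularNormalCone (hw k)
      (d := fun t => WithLp.toLp 2 (u - (p k).fst,
        γ - (p k).snd + r / 2 * (1 - t) * ‖u - (p k).fst‖ ^ 2))
      (d₀ := WithLp.toLp 2 (u - (p k).fst,
        γ - (p k).snd + r / 2 * (1 - 0) * ‖u - (p k).fst‖ ^ 2)) ?_ ?_
    · simp only [WithLp.prod_inner_apply] at this
      simp at this
      simp
      linarith
    · refine tendsto_nhdsWithin_of_tendsto_nhds (Continuous.tendsto ?_ 0)
      exact (WithLp.prod_continuous_toLp 2 X ℝ).comp (by fun_prop)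
    · have : Set.Ioo (0 : ℝ) 1 ∈ 𝓝[>] (0 : ℝ) := Ioo_mem_nhdsGT one_pos
      filter_upwards [this] with t ht
      have := hφ (p k).fst u (p k).snd γ t ht.1 ht.2 (hp k) hu
      simp only [epigraph, Set.mem_ofPred_eq]
      convert this using 2
      · simp
        module
      · simp [norm_sub_rev u]
        ring
  have hfst : Continuous fun q : WithLp 2 (X × ℝ) => q.fst :=
    continuous_fst.comp (WithLp.prod_continuous_ofLp 2 X ℝ)
  have hsnd : Continuous fun q : WithLp 2 (X × ℝ) => q.snd :=
    continuous_snd.comp (WithLp.prod_continuous_ofLp 2 X ℝ)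
  have h1 := (hfst.tendsto _).comp hpx
  have h2 := (hsnd.tendsto _).comp hpx
  have h3 := (hfst.tendsto _).comp hwv
  have h4 := (hsnd.tendsto _).comp hwv
  have h5 := (h3.inner (tendsto_const_nhds (x := u) |>.sub h1)).add (h4.mul
    (((tendsto_const_nhds (x := γ)).sub h2).add
      ((((tendsto_const_nhds (x := u)).sub h1).norm.pow 2).const_mul (r / 2))))
  have h6 := le_of_tendsto h5 (Eventually.of_forall key)
  simp at h6
  linarith

theorem EpiWeaklyConvex.mem_limitingSubdifferential_iff (hbot : ∀ x, φ x ≠ ⊥)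
    (hr : 0 ≤ r) (hφ : EpiWeaklyConvex r φ) {x v : X} :
    v ∈ limitingSubdifferential φ x ↔ IsQuadSubgradient r φ x v :=
  ⟨hφ.isQuadSubgradient_of_mem hbot, fun h => h.mem_limitingSubdifferential hbot hr⟩

end WeakConvexity

theorem isClosed_realEpigraph {X : Type*} [TopologicalSpace X] {φ : X → EReal}
    (hlsc : LowerSemicontinuous φ) :
    IsClosed {p : X × ℝ | φ p.1 ≤ (p.2 : EReal)} :=
  (hlsc.isClosed_epigraph).preimage
    (f := fun p : X × ℝ => (p.1, (p.2 : EReal)))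
    (continuous_fst.prodMk (continuous_coe_real_ereal.comp continuous_snd))

/-! ### Existence and Lipschitz continuity of the resolvent -/

section Resolvent

variable {X : Type*} [NormedAddCommGroup X] [InnerProductSpace ℝ X]
variable {φ : X → EReal} {r : ℝ}

/-- A weakly convex lower semicontinuous function has a quadratic minorant. -/
theorem EpiWeaklyConvex.exists_minorant [FiniteDimensional ℝ X] (hφ : EpiWeaklyConvex r φ)
    (hr : 0 ≤ r) (hbot : ∀ x, φ x ≠ ⊥) (hlsc : LowerSemicontinuous φ) {x₀ : X} {a₀ : ℝ}
    (hx₀ : φ x₀ ≤ a₀) :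
    ∃ A B : ℝ, 0 ≤ A ∧ 0 ≤ B ∧ ∀ (z : X) (γ : ℝ), φ z ≤ γ →
      -A - B * ‖z - x₀‖ - r / 2 * ‖z - x₀‖ ^ 2 ≤ γ := by
  have : ProperSpace X := FiniteDimensional.proper ℝ X
  obtain ⟨c, -, hc⟩ := (hlsc.lowerSemicontinuousOn (Metric.closedBall x₀ 1)).exists_isMinOn
    ⟨x₀, Metric.mem_closedBall_self zero_le_one⟩ (isCompact_closedBall x₀ 1)
  obtain ⟨m, -, hm⟩ := EReal.lt_iff_exists_real_btwn.1 (bot_lt_iff_ne_bot.2 (hbot c))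
  have hball : ∀ z, ‖z - x₀‖ ≤ 1 → ∀ γ : ℝ, φ z ≤ γ → m ≤ γ := by
    intro z hz γ hγ
    have h1 : φ c ≤ φ z := hc (by simpa [dist_eq_norm] using hz)
    exact EReal.coe_le_coe_iff.1 (hm.le.trans (h1.trans hγ))
  refine ⟨|m| + |a₀|, |m| + |a₀|, by positivity, by positivity, fun z γ hz => ?_⟩
  set R := ‖z - x₀‖ with hR
  have hR0 : 0 ≤ R := norm_nonneg _
  have hm1 := neg_abs_le m
  have ha1 := neg_abs_le a₀
  have ha2 := le_abs_self a₀
  rcases le_or_gt R 1 with h1 | h1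
  · have h2 := hball z h1 γ hz
    have h3 : 0 ≤ (|m| + |a₀|) * R := by positivity
    have h4 : 0 ≤ r / 2 * R ^ 2 := by positivity
    linarith [abs_nonneg a₀]
  · have hRp : 0 < R := zero_lt_one.trans h1
    -- The point of the segment from `x₀` to `z` at distance one from `x₀`: the bound on the unit
    -- ball propagates outwards.
    have h2 := hball ((1 - R⁻¹) • x₀ + R⁻¹ • z) (le_of_eq ?_) _
      (hφ x₀ z a₀ γ R⁻¹ (inv_pos.2 hRp) (inv_lt_one_of_one_lt₀ h1) hx₀ hz)
    · rw [norm_sub_rev, ← hR] at h2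
      have h3 := mul_le_mul_of_nonneg_left h2 hR0
      have h4 : R * ((1 - R⁻¹) * a₀ + R⁻¹ * γ + r / 2 * R⁻¹ * (1 - R⁻¹) * R ^ 2) =
          (R - 1) * a₀ + γ + r / 2 * (R ^ 2 - R) := by
        field_simp
      rw [h4] at h3
      have h5 : 0 ≤ r / 2 * R := by positivity
      nlinarith [mul_le_mul_of_nonneg_left hm1 hR0,
        mul_le_mul_of_nonneg_left ha2 (sub_nonneg.2 h1.le), abs_nonneg m, abs_nonneg a₀]
    · have : (1 - R⁻¹) • x₀ + R⁻¹ • z - x₀ = R⁻¹ • (z - x₀) := by module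
      rw [this, norm_smul, norm_inv, Real.norm_of_nonneg hR0, ← hR, inv_mul_cancel₀ hRp.ne']

/-- The point `x` minimizes `φ + ‖· - p‖ ^ 2 / (2 * l)`. Since `r ≤ κ`, the penalty beats the
quadratic minorant and sublevel sets are compact. -/
theorem EpiWeaklyConvex.exists_prox [FiniteDimensional ℝ X] (hφ : EpiWeaklyConvex r φ)
    (hr : 0 ≤ r) (hproper : IsProper φ) (hlsc : LowerSemicontinuous φ) {l : ℝ} (hl : 0 < l)
    (hlr : l * r ≤ 1 / 2) (p : X) : ∃ x, IsQuadSubgradient r φ x (l⁻¹ • (p - x)) := by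
  have : ProperSpace X := FiniteDimensional.proper ℝ X
  obtain ⟨hbot, x₀, htop⟩ := hproper
  obtain ⟨a₀, ha₀⟩ : ∃ a₀ : ℝ, φ x₀ ≤ a₀ := ⟨_, EReal.le_coe_toReal htop⟩
  obtain ⟨A, B, hA, hB, hAB⟩ := hφ.exists_minorant hr hbot hlsc ha₀
  set κ := l⁻¹ / 2 with hκ
  have hκ0 : 0 < κ := by positivity
  have hκr : r ≤ κ := by
    have := mul_le_mul_of_nonneg_left hlr (inv_pos.2 hl).le
    rw [inv_mul_cancel_left₀ hl.ne'] at this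
    linarith
  let f : X × ℝ → ℝ := fun q => q.2 + κ * ‖q.1 - p‖ ^ 2
  have hf : Continuous f := by fun_prop
  let E : Set (X × ℝ) := {q | φ q.1 ≤ (q.2 : EReal)}
  have hE : IsClosed E := isClosed_realEpigraph hlsc
  let S : Set (X × ℝ) := E ∩ {q | f q ≤ f (x₀, a₀)}
  have hS : IsCompact S := by
    refine Metric.isCompact_of_isClosed_isBounded
      (hE.inter (isClosed_le hf continuous_const)) ?_
    set M := f (x₀, a₀)
    set P := ‖p - x₀‖
    set ρ := 1 + 2 / κ * (B + 2 * κ * P + (|M| + A)) with hρ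
    have hP : 0 ≤ P := norm_nonneg _
    have hρ0 : 0 ≤ ρ := by positivity
    refine (Metric.isBounded_closedBall (x := x₀) (r := ρ)).prod
      (Metric.isBounded_Icc (-A - B * ρ - r / 2 * ρ ^ 2) M) |>.subset ?_
    rintro ⟨z, γ⟩ ⟨hz, hM⟩
    have h1 := hAB z γ hz
    have hM : γ + κ * ‖z - p‖ ^ 2 ≤ M := hM
    set R := ‖z - x₀‖ with hR
    have hR0 : 0 ≤ R := norm_nonneg _
    have h2 : (R - P) ^ 2 ≤ ‖z - p‖ ^ 2 := by
      have : z - p = (z - x₀) - (p - x₀) := by abel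
      rw [this]
      exact sq_le_sq.2 ((abs_norm_sub_norm_le _ _).trans (le_abs_self _))
    have h3 : R ≤ ρ := by
      have h4 : κ / 2 * R ^ 2 ≤ (B + 2 * κ * P) * R + (|M| + A) := by
        nlinarith [mul_le_mul_of_nonneg_left h2 hκ0.le, le_abs_self M,
          mul_le_mul_of_nonneg_right hκr (sq_nonneg R), mul_nonneg hκ0.le (sq_nonneg P)]
      rcases le_or_gt R 1 with h | h
      · exact h.trans (le_add_of_nonneg_right (by positivity))
      · have h5 : κ / 2 * R ≤ B + 2 * κ * P + (|M| + A) := by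
          have : 0 ≤ |M| + A := by positivity
          refine le_of_mul_le_mul_right ?_ (zero_lt_one.trans h)
          nlinarith
        have h6 : R = 2 / κ * (κ / 2 * R) := by field_simp
        rw [h6, hρ]
        have := mul_le_mul_of_nonneg_left h5 (by positivity : 0 ≤ 2 / κ)
        linarith
    refine ⟨by simpa [dist_eq_norm] using h3, ?_, ?_⟩
    · have h7 : R ^ 2 ≤ ρ ^ 2 := pow_le_pow_left₀ hR0 h3 2
      show _ ≤ γ
      nlinarith [mul_le_mul_of_nonneg_left h3 hB, mul_le_mul_of_nonneg_left h7 hr]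
    · show γ ≤ M
      nlinarith [mul_nonneg hκ0.le (sq_nonneg ‖z - p‖)]
  obtain ⟨⟨x, a⟩, hxS, hmin⟩ := hS.exists_isMinOn ⟨(x₀, a₀), ha₀, le_refl (f (x₀, a₀))⟩ hf.continuousOn
  have hmin' : ∀ (z : X) (γ : ℝ), φ z ≤ γ → f (x, a) ≤ f (z, γ) := by
    intro z γ hz
    rcases le_or_gt (f (z, γ)) (f (x₀, a₀)) with h | h
    · exact hmin (show (z, γ) ∈ S from ⟨hz, h⟩)
    · exact le_trans hxS.2 h.le
  refine ⟨x, a, hxS.1, fun z γ hz => ?_⟩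
  -- Minimality along the raised segment towards `(z, γ)`, divided by `t`; the limit `t → 0` is the
  -- support inequality.
  have key : ∀ t ∈ Set.Ioo (0 : ℝ) 1, 0 ≤ γ - a + r / 2 * (1 - t) * ‖z - x‖ ^ 2 +
      κ * (2 * inner ℝ (x - p) (z - x) + t * ‖z - x‖ ^ 2) := by
    rintro t ⟨ht0, ht1⟩
    have h1 : a + κ * ‖x - p‖ ^ 2 ≤ _ + κ * ‖_ - p‖ ^ 2 :=
      hmin' _ _ (hφ x z a γ t ht0 ht1 hxS.1 hz)
    have h2 : (1 - t) • x + t • z - p = (x - p) + t • (z - x) := by module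
    rw [h2, norm_add_sq_real, inner_smul_right, norm_smul, Real.norm_of_nonneg ht0.le,
      norm_sub_rev x z] at h1
    refine nonneg_of_mul_nonneg_right (a := t) ?_ ht0
    linarith
  have hlim : Tendsto (fun t : ℝ => γ - a + r / 2 * (1 - t) * ‖z - x‖ ^ 2 +
      κ * (2 * inner ℝ (x - p) (z - x) + t * ‖z - x‖ ^ 2)) (𝓝[>] 0) (𝓝 _) :=
    tendsto_nhdsWithin_of_tendsto_nhds (Continuous.tendsto (by fun_prop) 0)
  have h3 := ge_of_tendsto hlim (b := 0)
    (by filter_upwards [Ioo_mem_nhdsGT one_pos] with t ht using key t ht)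
  rw [inner_smul_left, ← neg_sub x p, inner_neg_left]
  simp only [hκ, conj_trivial] at h3 ⊢
  linarith

/-- Each support inequality is tested at the base point of the other, and the two are added. -/
theorem IsQuadSubgradient.inner_sub_ge {x x' v v' : X} (h : IsQuadSubgradient r φ x v)
    (h' : IsQuadSubgradient r φ x' v') :
    -(r * ‖x - x'‖ ^ 2) ≤ inner ℝ (v - v') (x - x') := by
  obtain ⟨a, ha, h⟩ := h
  obtain ⟨a', ha', h'⟩ := h'
  have h1 := h _ _ ha'
  have h2 := h' _ _ ha
  rw [← neg_sub x x', inner_neg_right, norm_neg] at h1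
  rw [inner_sub_left]
  linarith

/-- Lipschitz continuity of the resolvent. -/
theorem IsQuadSubgradient.norm_sub_le {l : ℝ} (hl : 0 < l) (hlr : l * r ≤ 1 / 2) {x x' p p' : X}
    (h : IsQuadSubgradient r φ x (l⁻¹ • (p - x)))
    (h' : IsQuadSubgradient r φ x' (l⁻¹ • (p' - x'))) : ‖x - x'‖ ≤ 2 * ‖p - p'‖ := by
  have h1 := mul_le_mul_of_nonneg_left (h.inner_sub_ge h') hl.le
  rw [← smul_sub, inner_smul_left, conj_trivial, mul_inv_cancel_left₀ hl.ne',
    show p - x - (p' - x') = (p - p') - (x - x') by abel, inner_sub_left,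
    real_inner_self_eq_norm_sq] at h1
  have h2 := real_inner_le_norm (p - p') (x - x')
  by_contra! h3
  have h4 : 0 < ‖x - x'‖ := lt_of_le_of_lt (by positivity) h3
  nlinarith [mul_le_mul_of_nonneg_right hlr (sq_nonneg ‖x - x'‖)]

end Resolvent

/-! ### From local proximal bounds to global inequalities -/

section Monotonicity

variable {X : Type*} [NormedAddCommGroup X] [InnerProductSpace ℝ X]

/-- Tangent-ball bound for the norm, from the concavity of the square root. -/
theorem norm_le_add_inner_div {x y : X} (hx : x ≠ 0) :
    ‖y‖ ≤ ‖x‖ + inner ℝ x (y - x) / ‖x‖ + ‖y - x‖ ^ 2 / (2 * ‖x‖) := by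
  have h0 : 0 < ‖x‖ := norm_pos_iff.2 hx
  have h1 : ‖y‖ ^ 2 = ‖x‖ ^ 2 + 2 * inner ℝ x (y - x) + ‖y - x‖ ^ 2 := by
    rw [← norm_add_sq_real, add_sub_cancel]
  have h2 : ‖x‖ + inner ℝ x (y - x) / ‖x‖ + ‖y - x‖ ^ 2 / (2 * ‖x‖) =
      (‖x‖ ^ 2 + ‖y‖ ^ 2) / (2 * ‖x‖) := by
    rw [h1]
    field_simp
    ring
  rw [h2, le_div_iff₀ (by positivity)]
  nlinarith [sq_nonneg (‖x‖ - ‖y‖)]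

/-- A Lipschitz map whose scalarizations have proximal subgradients `v` satisfying
`‖v‖ ^ 2 ≤ ⟪q, v⟫` is firmly nonexpansive. -/
theorem norm_sq_le_inner_of_proximal_subgradients [FiniteDimensional ℝ X] {J : X → X}
    (hJ : ∀ p p', ‖J p - J p'‖ ≤ 2 * ‖p - p'‖)
    (hsub : ∀ (q v p : X) (C : ℝ),
      (∀ p', inner ℝ v (p' - p) - C * ‖p' - p‖ ^ 2 ≤ inner ℝ q (J p' - J p)) →
        ‖v‖ ^ 2 ≤ inner ℝ q v) (a b : X) :
    ‖J a - J b‖ ^ 2 ≤ inner ℝ (J a - J b) (a - b) := by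
  have : ProperSpace X := FiniteDimensional.proper ℝ X
  have hJc : Continuous J :=
    (LipschitzWith.of_dist_le_mul (K := 2) fun x y => by
      simpa [dist_eq_norm] using hJ x y).continuous
  -- Firm nonexpansiveness of `J` is nonexpansiveness of `2J - I`. The bound says that `a` minimizes
  -- the penalized scalarization `h`; then `δ → 0`.
  have main : ∀ (q : X) (δ : ℝ), 0 < δ →
      inner ℝ q ((2 : ℝ) • (J a - J b) - (a - b)) ≤
        (‖q‖ + δ) * ‖b - a‖ + δ * ‖b - a‖ ^ 2 := by
    intro q δ hδ
    let h : X → ℝ := fun p =>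
      inner ℝ q ((2 : ℝ) • J p - p) + ((‖q‖ + δ) * ‖p - a‖ + δ * ‖p - a‖ ^ 2)
    have hc : Continuous h := by fun_prop
    have hha : h a = inner ℝ q ((2 : ℝ) • J a - a) := by simp [h]
    -- `2J - I` is 5-Lipschitz, so beyond this radius the term `δ * ‖p - a‖ ^ 2` dominates.
    have hρ : 0 ≤ 5 * ‖q‖ / δ := by positivity
    obtain ⟨p, -, hp⟩ := (isCompact_closedBall a (5 * ‖q‖ / δ)).exists_isMinOn
      ⟨a, Metric.mem_closedBall_self hρ⟩ hc.continuousOn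
    have hmin : ∀ p', h p ≤ h p' := by
      intro p'
      by_cases hp' : p' ∈ Metric.closedBall a (5 * ‖q‖ / δ)
      · exact hp hp'
      refine (hp (Metric.mem_closedBall_self hρ) : h p ≤ h a).trans ?_
      rw [Metric.mem_closedBall, dist_eq_norm, not_le, div_lt_iff₀ hδ] at hp'
      have h1 : -(‖q‖ * (5 * ‖p' - a‖)) ≤
          inner ℝ q ((2 : ℝ) • (J p' - J a) - (p' - a)) := by
        refine neg_le_of_abs_le ((abs_real_inner_le_norm _ _).trans
          (mul_le_mul_of_nonneg_left ?_ (norm_nonneg q)))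
        refine (norm_sub_le _ _).trans ?_
        rw [norm_smul]
        norm_num
        linarith [hJ p' a]
      have h2 : inner ℝ q ((2 : ℝ) • J p' - p') = inner ℝ q ((2 : ℝ) • J a - a) +
          inner ℝ q ((2 : ℝ) • (J p' - J a) - (p' - a)) := by
        rw [← inner_add_right]
        congr 1
        module
      rw [hha]
      show _ ≤ inner ℝ q ((2 : ℝ) • J p' - p') + _
      rw [h2]
      nlinarith [norm_nonneg (p' - a), norm_nonneg q,
        mul_nonneg (add_nonneg (norm_nonneg q) hδ.le) (norm_nonneg (p' - a))]
    have hpa : p = a := by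
      by_contra hne
      have hx : p - a ≠ 0 := sub_ne_zero.2 hne
      have hR : 0 < ‖p - a‖ := norm_pos_iff.2 hx
      set c := (‖q‖ + δ) / ‖p - a‖ + 2 * δ with hcdef
      have hc0 : 0 < c := by positivity
      -- Away from `a` the penalty has gradient `c • (p - a)` and a quadratic upper bound, so this
      -- vector is a proximal subgradient of `⟨q, J ·⟩` at `p`. The bound `‖v‖ ^ 2 ≤ ⟨q, v⟩` reads
      -- `‖2v - q‖ ≤ ‖q‖`, that is `‖c • (p - a)‖ ≤ ‖q‖`, whereas the choice of `c` makes that norm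
      -- exceed `‖q‖`.
      have h1 := hsub q ((1 / 2 : ℝ) • (q - c • (p - a))) p
        (((‖q‖ + δ) / (2 * ‖p - a‖) + δ) / 2) ?_
      · have h3 : ‖c • (p - a)‖ ^ 2 ≤ ‖q‖ ^ 2 := by
          rw [norm_smul, mul_pow, inner_smul_right, norm_sub_sq_real, inner_sub_right,
            real_inner_self_eq_norm_sq] at h1
          norm_num at h1
          linarith
        have h4 : ‖q‖ < ‖c • (p - a)‖ := by
          rw [norm_smul, Real.norm_of_nonneg hc0.le, hcdef, add_mul, div_mul_cancel₀ _ hR.ne']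
          nlinarith [mul_pos hδ hR]
        exact absurd h3 (not_le.2 (pow_lt_pow_left₀ h4 (norm_nonneg q) two_ne_zero))
      · intro p'
        have h1 : inner ℝ q ((2 : ℝ) • J p - p) + _ ≤ inner ℝ q ((2 : ℝ) • J p' - p') + _ :=
          hmin p'
        have h2 := norm_le_add_inner_div (y := p' - a) hx
        have h3 : ‖p' - a‖ ^ 2 =
            ‖p - a‖ ^ 2 + 2 * inner ℝ (p - a) (p' - p) + ‖p' - p‖ ^ 2 := by
          rw [← norm_add_sq_real]
          congr 2
          abel
        rw [sub_sub_sub_cancel_right] at h2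
        have h4 := mul_le_mul_of_nonneg_left h2 (add_nonneg (norm_nonneg q) hδ.le)
        rw [inner_smul_left, inner_sub_left, inner_smul_left, hcdef]
        simp only [inner_sub_right, inner_smul_right, conj_trivial] at h1 h3 h4 ⊢
        rw [h3] at h1
        have h5 : (‖q‖ + δ) * (‖p - a‖ + (inner ℝ (p - a) p' - inner ℝ (p - a) p) / ‖p - a‖ +
            ‖p' - p‖ ^ 2 / (2 * ‖p - a‖)) = (‖q‖ + δ) * ‖p - a‖ +
            (‖q‖ + δ) / ‖p - a‖ * (inner ℝ (p - a) p' - inner ℝ (p - a) p) +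
            (‖q‖ + δ) / (2 * ‖p - a‖) * ‖p' - p‖ ^ 2 := by
          field_simp
        rw [h5] at h4
        linarith
    have h1 := hmin b
    rw [hpa, hha] at h1
    have h2 : inner ℝ q ((2 : ℝ) • (J a - J b) - (a - b)) =
        inner ℝ q ((2 : ℝ) • J a - a) - inner ℝ q ((2 : ℝ) • J b - b) := by
      rw [← inner_sub_right]
      congr 1
      module
    rw [h2]
    exact sub_le_iff_le_add'.2 h1
  -- With this `q`, the limit of `main` is `‖q‖ ^ 2 ≤ ‖q‖ * ‖a - b‖`.
  set q := (2 : ℝ) • (J a - J b) - (a - b) with hq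
  have hlim : Tendsto (fun δ : ℝ => (‖q‖ + δ) * ‖b - a‖ + δ * ‖b - a‖ ^ 2) (𝓝[>] 0)
      (𝓝 ((‖q‖ + 0) * ‖b - a‖ + 0 * ‖b - a‖ ^ 2)) :=
    tendsto_nhdsWithin_of_tendsto_nhds (Continuous.tendsto (by fun_prop) 0)
  have h1 := ge_of_tendsto hlim (b := inner ℝ q q)
    (by filter_upwards [self_mem_nhdsWithin] with δ hδ using main q δ hδ)
  rw [real_inner_self_eq_norm_sq, norm_sub_rev b a] at h1
  have h2 : ‖q‖ ≤ ‖a - b‖ := by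
    by_contra! h3
    nlinarith [norm_nonneg (a - b)]
  have h3 := pow_le_pow_left₀ (norm_nonneg q) h2 2
  rw [hq, norm_sub_sq_real, norm_smul, inner_smul_left, mul_pow] at h3
  norm_num at h3
  linarith

/-- If `g` is monotone and gives affine minorants of `e` up to a quadratic error, then the
minorants are exact. -/
theorem add_inner_le_of_quadratic_of_monotone {e : X → ℝ} {g : X → X} {C : ℝ}
    (he : ∀ p p', e p + inner ℝ (g p) (p' - p) - C * ‖p' - p‖ ^ 2 ≤ e p')
    (hg : ∀ p p', 0 ≤ inner ℝ (g p - g p') (p - p')) (p p' : X) :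
    e p + inner ℝ (g p) (p' - p) ≤ e p' := by
  set d := p' - p with hd
  have step : ∀ s τ : ℝ, 0 ≤ s → 0 ≤ τ →
      e (p + s • d) + τ * inner ℝ (g p) d - C * τ ^ 2 * ‖d‖ ^ 2 ≤ e (p + (s + τ) • d) := by
    intro s τ hs hτ
    have h1 := he (p + s • d) (p + (s + τ) • d)
    have h2 : p + (s + τ) • d - (p + s • d) = τ • d := by module
    rw [h2, inner_smul_right, norm_smul, mul_pow, Real.norm_of_nonneg hτ] at h1
    have h3 : inner ℝ (g p) d ≤ inner ℝ (g (p + s • d)) d := by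
      rcases hs.eq_or_lt with rfl | hs
      · simp
      · have h4 := hg (p + s • d) p
        rw [add_sub_cancel_left, inner_smul_right, inner_sub_left] at h4
        linarith [nonneg_of_mul_nonneg_right h4 hs]
    nlinarith [mul_le_mul_of_nonneg_left h3 hτ]
  -- Cut the segment into `N + 1` equal pieces. By monotonicity the slope never drops below the
  -- initial one, and the quadratic errors add up to `C * ‖d‖ ^ 2 / (N + 1)`.
  have chain : ∀ (N k : ℕ), e p + k * (1 / (N + 1 : ℝ) * inner ℝ (g p) d) -
      k * (C * (1 / (N + 1 : ℝ)) ^ 2 * ‖d‖ ^ 2) ≤ e (p + (k * (1 / (N + 1 : ℝ))) • d) := by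
    intro N k
    induction k with
    | zero => simp
    | succ k ih =>
      have h1 := step (k * (1 / (N + 1 : ℝ))) (1 / (N + 1 : ℝ)) (by positivity) (by positivity)
      have h2 : ((k + 1 : ℕ) : ℝ) * (1 / (N + 1 : ℝ)) =
        k * (1 / (N + 1 : ℝ)) + 1 / (N + 1 : ℝ) := by push_cast; ring
      rw [h2]
      push_cast
      linarith
  have hlim : Tendsto (fun N : ℕ => e p + inner ℝ (g p) d - C * ‖d‖ ^ 2 * (1 / (N + 1 : ℝ)))
      atTop (𝓝 (e p + inner ℝ (g p) d - C * ‖d‖ ^ 2 * 0)) :=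
    tendsto_const_nhds.sub (tendsto_one_div_add_atTop_nhds_zero_nat.const_mul _)
  rw [mul_zero, sub_zero] at hlim
  refine le_of_tendsto hlim (Eventually.of_forall fun N => ?_)
  have h1 := chain N (N + 1)
  have h2 : (N + 1 : ℝ) ≠ 0 := by positivity
  have h3 : ((N + 1 : ℕ) : ℝ) * (1 / (N + 1 : ℝ)) = 1 := by push_cast; field_simp
  rw [h3, one_smul, ← mul_assoc, h3, hd, add_sub_cancel, ← hd] at h1
  have h4 : ((N + 1 : ℕ) : ℝ) * (C * (1 / (N + 1 : ℝ)) ^ 2 * ‖d‖ ^ 2) =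
      C * ‖d‖ ^ 2 * (1 / (N + 1 : ℝ)) := by push_cast; field_simp
  rw [h4] at h1
  linarith

end Monotonicity

/-! ### Second-order subdifferentials and convexity -/

section SecondOrder

variable {X : Type*} [NormedAddCommGroup X] [InnerProductSpace ℝ X]
variable {φ : X → EReal} {r : ℝ}

/-- Positive semidefiniteness passes from the combined to the limiting second-order
subdifferential. -/
theorem inner_nonneg_of_mem_limiting
    (h : ∀ x y : X, y ∈ limitingSubdifferential φ x →
      ∀ w : X, ∀ z ∈ combinedSecondSubdifferential φ x y w, 0 ≤ inner ℝ z w) {x y w z : X}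
    (hz : z ∈ limitingSecondSubdifferential φ x y w) : 0 ≤ inner ℝ z w := by
  obtain ⟨-, p, q, hp, -, hq, hpq⟩ := hz
  have hc := (WithLp.prod_continuous_ofLp 2 X X).tendsto (WithLp.toLp 2 (z, -w)) |>.comp hq
  have h1 := (continuous_fst.tendsto _).comp hc
  have h2 := (continuous_snd.tendsto _).comp hc
  have h3 := h1.inner (𝕜 := ℝ) h2.neg
  refine ge_of_tendsto (by simpa using h3) (Eventually.of_forall fun k => ?_)
  rw [← inner_neg_right]
  refine h (p k).fst (p k).snd (hp k) (-(q k).snd) (q k).fst ?_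
  show WithLp.toLp 2 ((q k).fst, - -(q k).snd) ∈
    regularNormalCone (graph (limitingSubdifferential φ)) (p k)
  rw [neg_neg]
  exact hpq k

variable [FiniteDimensional ℝ X]

/-- The combined second-order subdifferential of a convex function is positive semidefinite. -/
theorem EpiWeaklyConvex.inner_nonneg_of_mem_combined (hφ : EpiWeaklyConvex 0 φ)
    (hproper : IsProper φ) (hlsc : LowerSemicontinuous φ) {x y w z : X}
    (hz : z ∈ combinedSecondSubdifferential φ x y w) : 0 ≤ inner ℝ z w := by
  have hiff : ∀ x v, v ∈ limitingSubdifferential φ x ↔ IsQuadSubgradient 0 φ x v := fun x v =>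
    hφ.mem_limitingSubdifferential_iff hproper.1 le_rfl
  obtain ⟨hxy, hN⟩ := mem_regularNormalCone_iff.1 hz
  have hxy : IsQuadSubgradient 0 φ x y := (hiff _ _).1 hxy
  have hprox := fun p : X => hφ.exists_prox le_rfl hproper hlsc one_pos (by norm_num) p
  simp only [inv_one, one_smul] at hprox
  -- The graph is explored through resolvent points with parameter `x + y + t • u`. The increments
  -- sum to `t • u` and have nonnegative inner product, so neither their joint norm nor the norm of
  -- their difference exceeds `t * ‖u‖`.
  set u := z - w with hu
  choose J hJ using fun t : ℝ => hprox (x + y + t • u)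
  have hdec : ∀ t : ℝ, (J t - x) + (x + y + t • u - J t - y) = t • u := fun t => by module
  have hmono : ∀ t : ℝ, 0 ≤ inner ℝ (J t - x) (x + y + t • u - J t - y) := by
    intro t
    have := (hJ t).inner_sub_ge hxy
    rw [real_inner_comm]
    linarith
  set D : ℝ → WithLp 2 (X × X) := fun t =>
    WithLp.toLp 2 (J t - x, x + y + t • u - J t - y) with hD
  have hDnorm : ∀ t : ℝ, 0 ≤ t → ‖D t‖ ≤ t * ‖u‖ := by
    intro t ht
    refine le_of_sq_le_sq ?_ (by positivity)
    rw [WithLp.prod_norm_sq_eq_of_L2, mul_pow]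
    have h1 : ‖t • u‖ ^ 2 = t ^ 2 * ‖u‖ ^ 2 := by
      rw [norm_smul, mul_pow, Real.norm_of_nonneg ht]
    rw [← h1, ← hdec t, norm_add_sq_real]
    show ‖J t - x‖ ^ 2 + ‖x + y + t • u - J t - y‖ ^ 2 ≤ _
    linarith [hmono t]
  have hDtend : Tendsto (fun t => WithLp.toLp 2 (x, y) + D t) (𝓝[>] 0)
      (𝓝[graph (limitingSubdifferential φ)] (WithLp.toLp 2 (x, y))) := by
    refine tendsto_nhdsWithin_iff.2 ⟨?_, Eventually.of_forall fun t => ?_⟩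
    · have h1 : Tendsto D (𝓝[>] 0) (𝓝 0) := by
        refine squeeze_zero_norm' (a := fun t : ℝ => t * ‖u‖)
          (by filter_upwards [self_mem_nhdsWithin] with t ht using hDnorm t (le_of_lt ht)) ?_
        have : Tendsto (fun t : ℝ => t * ‖u‖) (𝓝[>] 0) (𝓝 (0 * ‖u‖)) :=
          tendsto_nhdsWithin_of_tendsto_nhds (Continuous.tendsto (by fun_prop) 0)
        simpa using this
      simpa using tendsto_const_nhds.add h1
    · show (y + (x + y + t • u - J t - y)) ∈ limitingSubdifferential φ (x + (J t - x))
      rw [add_sub_cancel, add_sub_cancel]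
      exact (hiff _ _).2 (hJ t)
  have key : ∀ ε : ℝ, 0 < ε → ‖u‖ ^ 2 ≤ ‖z + w‖ * ‖u‖ + 2 * ε * ‖u‖ := by
    intro ε hε
    obtain ⟨t, h1, ht⟩ := ((hDtend.eventually (hN ε hε)).and self_mem_nhdsWithin).exists
    have ht : 0 < t := ht
    rw [add_sub_cancel_left] at h1
    have h2 := h1.trans (mul_le_mul_of_nonneg_left (hDnorm t ht.le) hε.le)
    set dx := J t - x with hdx
    set dy := x + y + t • u - J t - y with hdy
    have h3 : inner ℝ z dx - inner ℝ w dy ≤ ε * (t * ‖u‖) := by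
      rw [WithLp.prod_inner_apply] at h2
      have h2 : inner ℝ z dx + inner ℝ (-w) dy ≤ ε * (t * ‖u‖) := h2
      rwa [inner_neg_left, ← sub_eq_add_neg] at h2
    have h4 : ‖dx - dy‖ ≤ t * ‖u‖ := by
      refine le_of_sq_le_sq ?_ (by positivity)
      have h1 : ‖t • u‖ ^ 2 = (t * ‖u‖) ^ 2 := by
        rw [norm_smul, Real.norm_of_nonneg ht.le]
      rw [← h1, ← hdec t, norm_add_sq_real, norm_sub_sq_real]
      linarith [hmono t]
    have hdec' : t • u = dx + dy := (hdec t).symm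
    have h5 : 2 * (inner ℝ z dx - inner ℝ w dy) =
        inner ℝ u (t • u) + inner ℝ (z + w) (dx - dy) := by
      rw [hdec', hu]
      simp only [inner_sub_left, inner_add_left, inner_add_right, inner_sub_right]
      ring
    have h6 := neg_le_of_abs_le ((abs_real_inner_le_norm (z + w) (dx - dy)).trans
      (mul_le_mul_of_nonneg_left h4 (norm_nonneg _)))
    rw [inner_smul_right, real_inner_self_eq_norm_sq] at h5
    refine le_of_mul_le_mul_left ?_ ht
    linarith
  have hlim : Tendsto (fun ε : ℝ => ‖z + w‖ * ‖u‖ + 2 * ε * ‖u‖) (𝓝[>] 0)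
      (𝓝 (‖z + w‖ * ‖u‖ + 2 * 0 * ‖u‖)) :=
    tendsto_nhdsWithin_of_tendsto_nhds (Continuous.tendsto (by fun_prop) 0)
  have h1 := ge_of_tendsto hlim
    (by filter_upwards [self_mem_nhdsWithin] with ε hε using key ε hε)
  have h2 : ‖u‖ ≤ ‖z + w‖ := by
    by_contra! h3
    nlinarith [norm_nonneg (z + w)]
  have h3 := pow_le_pow_left₀ (norm_nonneg u) h2 2
  rw [hu, norm_sub_sq_real, norm_add_sq_real] at h3
  linarith

/-- Under positive semidefiniteness of the combined second-order subdifferential, resolvents are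
firmly nonexpansive. -/
theorem resolvent_firmly_nonexpansive (hr : 0 ≤ r) (hbot : ∀ x, φ x ≠ ⊥)
    (hφ : EpiWeaklyConvex r φ)
    (h : ∀ x y : X, y ∈ limitingSubdifferential φ x →
      ∀ w : X, ∀ z ∈ combinedSecondSubdifferential φ x y w, 0 ≤ inner ℝ z w)
    {l : ℝ} (hl : 0 < l) (hlr : l * r ≤ 1 / 2) {J : X → X}
    (hJ : ∀ p, IsQuadSubgradient r φ (J p) (l⁻¹ • (p - J p))) (a b : X) :
    ‖J a - J b‖ ^ 2 ≤ inner ℝ (J a - J b) (a - b) := by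
  refine norm_sq_le_inner_of_proximal_subgradients
    (fun p p' => (hJ p).norm_sub_le hl hlr (hJ p')) (fun q v p C hC => ?_) a b
  have hmem : ∀ p, l⁻¹ • (p - J p) ∈ limitingSubdifferential φ (J p) := fun p =>
    (hJ p).mem_limitingSubdifferential hbot hr
  -- Every graph point satisfies `x' = J (x' + l • y')`, so the proximal inequality for `⟨q, J ·⟩`
  -- becomes one for the normal `(v - q, l • v)`.
  have hN : v - q ∈ combinedSecondSubdifferential φ (J p) (l⁻¹ • (p - J p)) (-(l • v)) := by
    refine mem_regularNormalCone_of_quadratic (hmem p) (|C| * (2 * (1 + l ^ 2))) ?_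
    rintro ⟨⟨x', y'⟩⟩ hxy
    have hxy : y' ∈ limitingSubdifferential φ x' := hxy
    have hxy' := hφ.isQuadSubgradient_of_mem hbot hxy
    have hx' : J (x' + l • y') = x' := by
      have h1 := (hJ (x' + l • y')).norm_sub_le (p' := x' + l • y') hl hlr (x' := x')
        (by rwa [add_sub_cancel_left, inv_smul_smul₀ hl.ne'])
      rw [sub_self, norm_zero, mul_zero] at h1
      exact sub_eq_zero.1 (norm_le_zero_iff.1 h1)
    have h1 := hC (x' + l • y')
    rw [hx'] at h1
    set dx := x' - J p with hdx
    set dy := y' - l⁻¹ • (p - J p) with hdy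
    have h2 : x' + l • y' - p = dx + l • dy := by
      rw [hdx, hdy, smul_sub, smul_inv_smul₀ hl.ne']
      abel
    rw [h2, inner_add_right, inner_smul_right] at h1
    have h3 : ‖dx + l • dy‖ ^ 2 ≤ 2 * (1 + l ^ 2) * (‖dx‖ ^ 2 + ‖dy‖ ^ 2) := by
      have h4 := norm_add_le dx (l • dy)
      rw [norm_smul, Real.norm_of_nonneg hl.le] at h4
      refine (pow_le_pow_left₀ (norm_nonneg _) h4 2).trans ?_
      nlinarith [sq_nonneg (‖dx‖ - l * ‖dy‖), sq_nonneg ‖dx‖, sq_nonneg ‖dy‖,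
        sq_nonneg (l * ‖dx‖)]
    have h4 := (mul_le_mul_of_nonneg_right (le_abs_self C) (sq_nonneg ‖dx + l • dy‖)).trans
      (mul_le_mul_of_nonneg_left h3 (abs_nonneg C))
    rw [WithLp.prod_norm_sq_eq_of_L2, WithLp.prod_inner_apply, neg_neg]
    show inner ℝ (v - q) dx + inner ℝ (l • v) dy ≤
      |C| * (2 * (1 + l ^ 2)) * (‖dx‖ ^ 2 + ‖dy‖ ^ 2)
    rw [inner_sub_left, inner_smul_left, conj_trivial]
    linarith
  have h1 := h _ _ (hmem p) _ _ hN
  rw [inner_neg_right, inner_smul_right, inner_sub_left, real_inner_self_eq_norm_sq] at h1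
  have h2 : 0 ≤ l * (inner ℝ q v - ‖v‖ ^ 2) := by linarith
  linarith [nonneg_of_mul_nonneg_right h2 hl]

/-- The Moreau envelope of `φ` has an affine support at every point. -/
theorem exists_moreau_support (hr : 0 ≤ r) (hproper : IsProper φ) (hlsc : LowerSemicontinuous φ)
    (hφ : EpiWeaklyConvex r φ)
    (h : ∀ x y : X, y ∈ limitingSubdifferential φ x →
      ∀ w : X, ∀ z ∈ combinedSecondSubdifferential φ x y w, 0 ≤ inner ℝ z w)
    {l : ℝ} (hl : 0 < l) (hlr : l * r ≤ 1 / 2) (c : X) :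
    ∃ (x v : X) (a : ℝ), φ x ≤ a ∧ ∀ (z : X) (γ : ℝ), φ z ≤ γ →
      a + l⁻¹ / 2 * ‖c - x‖ ^ 2 + inner ℝ v (z - c) ≤ γ := by
  choose J hJ using hφ.exists_prox hr hproper hlsc hl hlr
  have hJ' := hJ
  choose A hA hA' using hJ'
  have hfne := resolvent_firmly_nonexpansive hr hproper.1 hφ h hl hlr hJ
  have hlip : ∀ p p', ‖J p - J p'‖ ≤ ‖p - p'‖ := by
    intro p p'
    have h1 := (hfne p p').trans (real_inner_le_norm _ _)
    by_contra! h2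
    nlinarith [norm_nonneg (p - p')]
  have hl' : 0 < l⁻¹ := inv_pos.2 hl
  -- `e` is the Moreau envelope and `g` its gradient candidate. Nonexpansiveness of `J` gives both
  -- the error constant `r / 2` and the monotonicity of `g`.
  have key := add_inner_le_of_quadratic_of_monotone
    (e := fun p => A p + l⁻¹ / 2 * ‖p - J p‖ ^ 2) (g := fun p => l⁻¹ • (p - J p)) (C := r / 2)
    (fun p p' => ?_) (fun p p' => ?_)
  · refine ⟨J c, l⁻¹ • (c - J c), A c, hA c, fun z γ hz => (key c z).trans ?_⟩
    have h1 := hA' z z γ hz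
    rw [inner_smul_left, conj_trivial, real_inner_self_eq_norm_sq] at h1
    have h2 : r ≤ l⁻¹ := by
      have := mul_le_mul_of_nonneg_left hlr hl'.le
      rw [inv_mul_cancel_left₀ hl.ne'] at this
      linarith
    show A z + l⁻¹ / 2 * ‖z - J z‖ ^ 2 ≤ γ
    nlinarith [mul_le_mul_of_nonneg_right h2 (sq_nonneg ‖z - J z‖)]
  · have h1 := hA' p _ _ (hA p')
    have h2 := mul_le_mul_of_nonneg_left (pow_le_pow_left₀ (norm_nonneg _) (hlip p' p) 2)
      (div_nonneg hr two_pos.le)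
    have h3 : ‖p' - J p'‖ ^ 2 = ‖p - J p‖ ^ 2 + 2 * inner ℝ (p - J p)
        ((p' - p) - (J p' - J p)) + ‖(p' - p) - (J p' - J p)‖ ^ 2 := by
      rw [← norm_add_sq_real]
      congr 2
      abel
    rw [h3, inner_smul_left, conj_trivial, inner_sub_right (p - J p) (p' - p)]
    rw [inner_smul_left, conj_trivial] at h1
    nlinarith [mul_nonneg hl'.le (sq_nonneg ‖(p' - p) - (J p' - J p)‖)]
  · rw [← smul_sub, inner_smul_left, conj_trivial,
      show p - J p - (p' - J p') = (p - p') - (J p - J p') by abel, inner_sub_left,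
      real_inner_self_eq_norm_sq]
    refine mul_nonneg hl'.le ?_
    have h1 := (real_inner_le_norm (J p - J p') (p - p')).trans
      (mul_le_mul_of_nonneg_right (hlip p p') (norm_nonneg _))
    nlinarith

/-- Averaging the affine support of the envelope at `c` over `x` and `y` cancels its linear part and
bounds the envelope at `c` by `M`. With `l = 1 / (k + 1)`, the prox points `u k` satisfy `φ (u k) ≤
M` for large `k` and tend to `c`. -/
theorem EpiWeaklyConvex.convex_of_inner_nonneg (hr : 0 ≤ r) (hproper : IsProper φ)
    (hlsc : LowerSemicontinuous φ) (hφ : EpiWeaklyConvex r φ)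
    (h : ∀ x y : X, y ∈ limitingSubdifferential φ x →
      ∀ w : X, ∀ z ∈ combinedSecondSubdifferential φ x y w, 0 ≤ inner ℝ z w) :
    EpiWeaklyConvex 0 φ := by
  intro x y α β t ht0 ht1 hx hy
  obtain ⟨A, B, hA, hB, hAB⟩ := hφ.exists_minorant hr hproper.1 hlsc
    (hφ x y α β t ht0 ht1 hx hy)
  set c := (1 - t) • x + t • y with hc
  set M := (1 - t) * α + t * β with hM
  set K := B / 2 + r / 2 with hK
  have hl0 : ∀ k : ℕ, 0 < (1 : ℝ) / (k + 1) := fun k => by positivity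
  have hlim : Tendsto (fun k : ℕ => (1 : ℝ) / (k + 1)) atTop (𝓝 0) :=
    tendsto_one_div_add_atTop_nhds_zero_nat
  have hsmall : ∀ᶠ k : ℕ in atTop, (1 : ℝ) / (k + 1) * r < 1 / 2 ∧ (1 : ℝ) / (k + 1) * K < 1 / 4 := by
    have h1 := hlim.mul_const r
    have h2 := hlim.mul_const K
    rw [zero_mul] at h1 h2
    exact (h1.eventually_lt_const (by norm_num)).and (h2.eventually_lt_const (by norm_num))
  have hex : ∀ k : ℕ, ∃ u : X, (1 : ℝ) / (k + 1) * r < 1 / 2 ∧ (1 : ℝ) / (k + 1) * K < 1 / 4 →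
      φ u ≤ M ∧ ‖u - c‖ ^ 2 ≤ 4 * (M + A + B) * (1 / (k + 1)) := by
    intro k
    by_cases hk : (1 : ℝ) / (k + 1) * r < 1 / 2 ∧ (1 : ℝ) / (k + 1) * K < 1 / 4
    swap
    · exact ⟨c, fun h => absurd h hk⟩
    set l := (1 : ℝ) / (k + 1) with hl
    obtain ⟨u, v, a, hua, hsup⟩ :=
      exists_moreau_support hr hproper hlsc hφ h (hl0 k) hk.1.le c
    refine ⟨u, fun _ => ?_⟩
    have h1 := mul_le_mul_of_nonneg_left (hsup x α hx) (sub_pos.2 ht1).le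
    have h2 := mul_le_mul_of_nonneg_left (hsup y β hy) ht0.le
    have h3 : (1 - t) * inner ℝ v (x - c) + t * inner ℝ v (y - c) = 0 := by
      rw [← inner_smul_right, ← inner_smul_right, ← inner_add_right, hc]
      have : (1 - t) • (x - ((1 - t) • x + t • y)) + t • (y - ((1 - t) • x + t • y)) = 0 := by
        module
      rw [this, inner_zero_right]
    have h4 : a + l⁻¹ / 2 * ‖c - u‖ ^ 2 ≤ M := by
      rw [hM]
      linarith
    have hlp : 0 < l := hl0 k
    have h5 : 0 ≤ l⁻¹ / 2 * ‖c - u‖ ^ 2 := by positivity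
    refine ⟨hua.trans (EReal.coe_le_coe_iff.2 (by linarith)), ?_⟩
    have h6 := hAB u a hua
    rw [norm_sub_rev c u] at h4
    set d := ‖u - c‖
    -- The minorant bounds `a` from below, with `B * d` absorbed by `B / 2 * (1 + d ^ 2)`. As `l * K
    -- < 1/4`, the term `K * d ^ 2` moves to the left.
    have h7 : l⁻¹ / 2 * d ^ 2 ≤ M + A + B + K * d ^ 2 := by
      rw [hK]
      nlinarith [mul_nonneg hB (sq_nonneg (d - 1))]
    have h8 := mul_le_mul_of_nonneg_left h7 (by positivity : 0 ≤ 4 * l)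
    have h9 : 4 * l * (l⁻¹ / 2 * d ^ 2) = 2 * d ^ 2 := by field_simp; norm_num
    rw [h9] at h8
    nlinarith [mul_le_mul_of_nonneg_right hk.2.le (sq_nonneg d)]
  choose u hu using hex
  have hutend : Tendsto u atTop (𝓝 c) := by
    rw [tendsto_iff_norm_sub_tendsto_zero]
    have h1 : Tendsto (fun k => ‖u k - c‖ ^ 2) atTop (𝓝 0) := by
      have h2 := hlim.const_mul (4 * (M + A + B))
      rw [mul_zero] at h2
      exact squeeze_zero' (Eventually.of_forall fun k => sq_nonneg _)
        (hsmall.mono fun k hk => (hu k hk).2) h2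
    simpa [Real.sqrt_sq] using h1.sqrt
  have hcl := (isClosed_realEpigraph hlsc).mem_of_tendsto
    (hutend.prodMk_nhds (tendsto_const_nhds (x := M))) (hsmall.mono fun k hk => (hu k hk).1)
  have hcl : φ c ≤ (M : EReal) := hcl
  simpa using hcl

end SecondOrder

end VarAnalysis

theorem mainTheorem3 (n : ℕ) (φ : EuclideanSpace ℝ (Fin n) → EReal)
    (hproper : VarAnalysis.IsProper φ) (hlsc : LowerSemicontinuous φ) :
    List.TFAE
      [VarAnalysis.IsConvex φ,
       VarAnalysis.IsWeaklyConvex φ ∧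
         ∀ x y : EuclideanSpace ℝ (Fin n), y ∈ VarAnalysis.limitingSubdifferential φ x →
           ∀ w : EuclideanSpace ℝ (Fin n),
             ∀ z ∈ VarAnalysis.combinedSecondSubdifferential φ x y w, 0 ≤ inner ℝ z w,
       VarAnalysis.IsWeaklyConvex φ ∧
         ∀ x y : EuclideanSpace ℝ (Fin n), y ∈ VarAnalysis.limitingSubdifferential φ x →
           ∀ w : EuclideanSpace ℝ (Fin n),
             ∀ z ∈ VarAnalysis.limitingSecondSubdifferential φ x y w, 0 ≤ inner ℝ z w] := by
  tfae_have 1 → 2 := by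
    intro h
    have h0 : VarAnalysis.EpiWeaklyConvex 0 φ := by
      simpa using VarAnalysis.SConvexOn.epiWeaklyConvex h
    -- Weak convexity requires a strictly negative modulus, so convexity is relaxed to `s = -1`.
    refine ⟨⟨-1, by norm_num, ?_⟩, fun x y _ w z hz =>
      h0.inner_nonneg_of_mem_combined hproper hlsc hz⟩
    refine VarAnalysis.EpiWeaklyConvex.sConvexOn (r := 1)
      (fun x y α β t ht0 ht1 hx hy => (h0 x y α β t ht0 ht1 hx hy).trans ?_) hproper.1
    refine EReal.coe_le_coe_iff.2 ?_
    have : 0 ≤ 1 / 2 * t * (1 - t) * ‖x - y‖ ^ 2 :=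
      mul_nonneg (mul_nonneg (by linarith) (by linarith)) (sq_nonneg _)
    linarith
  tfae_have 2 → 3 := fun h => ⟨h.1, fun x y _ w z hz =>
    VarAnalysis.inner_nonneg_of_mem_limiting h.2 hz⟩
  tfae_have 3 → 2 := fun h => ⟨h.1, fun x y hy w z hz => h.2 x y hy w z
    (VarAnalysis.regularNormalCone_subset_limitingNormalCone _ _ hz)⟩
  tfae_have 2 → 1 := by
    rintro ⟨⟨s, hs, hφ⟩, h⟩
    have h0 := hφ.epiWeaklyConvex.convex_of_inner_nonneg (by linarith) hproper hlsc h
    simpa [VarAnalysis.IsConvex] using h0.sConvexOn hproper.1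
  tfae_finish
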